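/- Let $W_\lambda$ be the semigroup with zero given by the presentation $$W_\lambda=\langle a,x,y \mid a^2=x^2=y^2=xy=yx=0;\ ax=axax;\ ay=ayay;\ xa=xaxa;\ ya=yaya;\ xay=xax;\ yax=yay\rangle .$$ Let $\mathbf{W_\lambda}$ be the variety of semigroups generated by $W_\lambda$, i.e. the class of all homomorphic images of subsemigroups of direct powers of $W_\lambda$. Then the four identities $$a^2\approx a^3,\qquad aba\approx ababa,\qquad abc^2d^2\approx abd^2c^2,\qquad a^2b^2\approx ab^2a$$ (in which $a,b,c,d$ are distinct letters of a countably infinite alphabet) form an identity basis of $\mathbf{W_\lambda}$. That is, a semigroup belongs to $\mathbf{W_\lambda}$ if and only if it satisfies these four identities, and a semigroup identity $u\approx v$ holds in $\mathbf{W_\lambda}$ if and only if it can be deduced from these four identities (by substitution of words for letters, multiplication, reflexivity, symmetry and transitivity). -/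

import Mathlib

universe u

/-- Words: elements of the free semigroup over a countably infinite alphabet (the letters are
indexed by natural numbers). -/
abbrev SgWord : Type := FreeSemigroup ℕ

/-- A semigroup identity `lhs ≈ rhs`. -/
structure SgIdentity where
  lhs : SgWord
  rhs : SgWord

/-- The semigroup `T` satisfies the identity `e`: both sides have the same value under every
homomorphism from the free semigroup to `T`. -/
def SgSatisfies (T : Type u) [Semigroup T] (e : SgIdentity) : Prop :=
  ∀ φ : SgWord →ₙ* T, φ e.lhs = φ e.rhs

/-- A class of semigroups (in a fixed universe). -/
abbrev SgClass : Type (u + 1) := ∀ (T : Type u) [Semigroup T], Prop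

/-- The identity `e` holds in every member of the class `V`. -/
def SgHoldsIn (V : SgClass.{u}) (e : SgIdentity) : Prop :=
  ∀ (T : Type u) [Semigroup T], V T → SgSatisfies T e

/-- The variety defined by a set `B` of identities. -/
def varietyDefinedBy (B : Set SgIdentity) : SgClass.{u} :=
  fun T [Semigroup T] => ∀ e ∈ B, SgSatisfies T e

/-- The variety generated by the semigroup `S`: the homomorphic images of subsemigroups of direct
powers of `S`. -/
def varietyGeneratedBy (S : Type) [Semigroup S] : SgClass.{u} :=
  fun T [Semigroup T] =>
    ∃ (I : Type u) (A : Subsemigroup (I → S)) (f : A →ₙ* T), Function.Surjective f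

/-- Deducibility of the identity `p ≈ q` from the set `B` of identities, by the rules of
equational logic for semigroups. -/
inductive SgDeducible (B : Set SgIdentity) : SgWord → SgWord → Prop
  | subst (e : SgIdentity) (he : e ∈ B) (σ : SgWord →ₙ* SgWord) :
      SgDeducible B (σ e.lhs) (σ e.rhs)
  | refl (p : SgWord) : SgDeducible B p p
  | symm {p q : SgWord} : SgDeducible B p q → SgDeducible B q p
  | trans {p q r : SgWord} : SgDeducible B p q → SgDeducible B q r → SgDeducible B p r
  | mul {p q p' q' : SgWord} :
      SgDeducible B p q → SgDeducible B p' q' → SgDeducible B (p * p') (q * q')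

/-- `B` is an identity basis of the class `V`: `V` is the variety defined by `B`, and the
identities holding in `V` are exactly those deducible from `B`. -/
def IsIdentityBasis (B : Set SgIdentity) (V : SgClass.{u}) : Prop :=
  (∀ (T : Type u) [Semigroup T], V T ↔ varietyDefinedBy B T) ∧
    ∀ e : SgIdentity, SgHoldsIn V e ↔ SgDeducible B e.lhs e.rhs

/-- The three generators of `W_λ`. -/
inductive WGen : Type
  | a
  | x
  | y

/-- The free semigroup with zero on the three generators. -/
abbrev WFree : Type := WithZero (FreeSemigroup WGen)

/-- A generator as an element of the free semigroup with zero. -/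
def wgen (g : WGen) : WFree := ((FreeSemigroup.of g : FreeSemigroup WGen) : WFree)

/-- The defining relations of `W_λ`. -/
inductive WRel : WFree → WFree → Prop
  | aa : WRel (wgen .a * wgen .a) 0
  | xx : WRel (wgen .x * wgen .x) 0
  | yy : WRel (wgen .y * wgen .y) 0
  | xy : WRel (wgen .x * wgen .y) 0
  | yx : WRel (wgen .y * wgen .x) 0
  | ax : WRel (wgen .a * wgen .x) (wgen .a * wgen .x * wgen .a * wgen .x)
  | ay : WRel (wgen .a * wgen .y) (wgen .a * wgen .y * wgen .a * wgen .y)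
  | xa : WRel (wgen .x * wgen .a) (wgen .x * wgen .a * wgen .x * wgen .a)
  | ya : WRel (wgen .y * wgen .a) (wgen .y * wgen .a * wgen .y * wgen .a)
  | xay : WRel (wgen .x * wgen .a * wgen .y) (wgen .x * wgen .a * wgen .x)
  | yax : WRel (wgen .y * wgen .a * wgen .x) (wgen .y * wgen .a * wgen .y)

/-- The semigroup `W_λ`, given by its presentation as a semigroup with zero:
`⟨a, x, y ∣ a² = x² = y² = xy = yx = 0; ax = axax; ay = ayay; xa = xaxa; ya = yaya;
xay = xax; yax = yay⟩`. -/
abbrev WLambda : Type := (conGen WRel).Quotient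

/-- The word consisting of the single letter with index `n`. -/
def letter (n : ℕ) : SgWord := FreeSemigroup.of n

/-- The four identities `a² ≈ a³`, `aba ≈ ababa`, `abc²d² ≈ abd²c²`, `a²b² ≈ ab²a`. -/
def wLambdaIdentities : Set SgIdentity :=
  let a := letter 0
  let b := letter 1
  let c := letter 2
  let d := letter 3
  {⟨a * a, a * a * a⟩,
   ⟨a * b * a, a * b * a * b * a⟩,
   ⟨a * b * (c * c) * (d * d), a * b * (d * d) * (c * c)⟩,
   ⟨a * a * (b * b), a * (b * b) * a⟩}

/-!
A word is read as a walk in a graph whose edges are the letters: the letter `c` leads from a vertex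
`l c` to a vertex `r c`. A nonzero element of `W_λ` begins with `a` or not, ends with `a` or not,
and otherwise only remembers its first letter other than `a`; hence a product of elements of `W_λ`
is nonzero exactly when it is a walk in a two-vertex graph. It follows that the two sides of an
identity of `W_λ` have the same content, are walks with the same ends in the same graphs, and have
the same first letter and also the same second letter, unless the first letter is a loop in every
such graph (`sameShape_of_satisfies`). The converse to be proved is that words of the same shape
are equal in the relatively free semigroup of the four identities (`wordClass_eq_of_sameShape`).

The key is a fact about Green's relation `R` in the relatively free semigroup: if
`m = m c s = m r c t` with `c` nonempty and `m` a product of two elements, then `m = m r`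
(`RelFree.eq_mul_of_two_edges`). Thus inside the `R`-class of a word every letter labels at most one
edge, and the `R`-class is itself a graph in which the word can be walked, once the letters that
cannot be read inside the `R`-class are treated as edges outside it. These letters are separated
from the others: a word is `x b w`, where `b` occurs only once, `x` and `w` have no letter in
common, and all letters of `w` can be read inside the `R`-class (`exists_cut`). A word `s` that is
a closed walk at the end of `u` in every graph in which `u` is a walk is in particular a closed walk
in the graph of the `R`-class, whence `u s = u` (`Cut.append_closed`).

Given two words of the same shape, the parts before `b` agree by induction, so that the words may be
assumed to be `p q` and `p q'` with the same walks. With a walk `z` back from the end, the loops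
`e = q z` and `f = q' z` satisfy `p q = p e² f² q'` and `p q' = p f² e² q'`, and the squares commute
as soon as `p` has two letters (`wordClass_eq_of_common_prefix`). If no such common prefix is at
hand, the first letter is a loop and can be doubled by means of `a² b² = a b² a`
(`wordClass_cons_loop`).

Birkhoff's theorem then turns the description of the identities into one of the variety
(`varietyGeneratedBy_of_forall_satisfies`).
-/

/-! ### The relatively free monoid -/

/-- Deducibility from the four identities, as a congruence on the free semigroup. -/
def deducibleCon : Con SgWord where
  r := SgDeducible wLambdaIdentities
  iseqv := ⟨.refl, .symm, .trans⟩
  mul' := .mul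

/-- The relatively free semigroup of the four identities, with an identity element adjoined. -/
abbrev RelFree : Type := WithOne deducibleCon.Quotient

/-- The class of a letter in `RelFree`. -/
def gen (n : ℕ) : RelFree := ((letter n : deducibleCon.Quotient) : RelFree)

/-- The class of a possibly empty word in `RelFree`. -/
def wordClass (w : List ℕ) : RelFree := (w.map gen).prod

/-- The list of letters of an element of the free semigroup. -/
def letters {α : Type*} (p : FreeSemigroup α) : List α := p.head :: p.tail

@[simp] lemma wordClass_nil : wordClass [] = 1 := rfl

@[simp] lemma wordClass_cons (c : ℕ) (w : List ℕ) :
    wordClass (c :: w) = gen c * wordClass w := by simp [wordClass]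

@[simp] lemma wordClass_append (v w : List ℕ) :
    wordClass (v ++ w) = wordClass v * wordClass w := by simp [wordClass]

lemma RelFree.eq_one_or_coe (x : RelFree) :
    x = 1 ∨ ∃ a : deducibleCon.Quotient, x = (a : RelFree) :=
  WithOne.cases_on x (.inl rfl) fun a => .inr ⟨a, rfl⟩

lemma RelFree.mul_ne_one_left {x : RelFree} (y : RelFree) (hx : x ≠ 1) : x * y ≠ 1 := by
  obtain rfl | ⟨a, rfl⟩ := RelFree.eq_one_or_coe x
  · exact absurd rfl hx
  · obtain rfl | ⟨b, rfl⟩ := RelFree.eq_one_or_coe y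
    · rwa [mul_one]
    · rw [← WithOne.coe_mul]; exact WithOne.coe_ne_one

lemma RelFree.mul_ne_one_right (x : RelFree) {y : RelFree} (hy : y ≠ 1) : x * y ≠ 1 := by
  obtain rfl | ⟨a, rfl⟩ := RelFree.eq_one_or_coe x
  · rwa [one_mul]
  · exact RelFree.mul_ne_one_left _ WithOne.coe_ne_one

lemma gen_ne_one (n : ℕ) : gen n ≠ 1 := WithOne.coe_ne_one

lemma exists_letters {w : List ℕ} (hw : w ≠ []) : ∃ p : SgWord, letters p = w := by
  cases w with
  | nil => exact absurd rfl hw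
  | cons a s => exact ⟨⟨a, s⟩, rfl⟩

lemma letters_mul {α : Type*} (p q : FreeSemigroup α) :
    letters (p * q) = letters p ++ letters q := by
  simp [letters]

lemma letters_letter (n : ℕ) : letters (letter n) = [n] := rfl

lemma SgWord.induction {C : SgWord → Prop} (p : SgWord) (h1 : ∀ n, C (letter n))
    (h2 : ∀ n q, C q → C (letter n * q)) : C p :=
  FreeSemigroup.recOnMul p h1 fun n q _ hq => h2 n q hq

lemma wordClass_letters (p : SgWord) :
    wordClass (letters p) = ((p : deducibleCon.Quotient) : RelFree) := by
  induction p using SgWord.induction with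
  | h1 n => simp [letters_letter, gen]
  | h2 n q ih =>
    rw [letters_mul, wordClass_append, ih, letters_letter]
    simp [gen]

lemma wordClass_letters_eq_iff {p q : SgWord} :
    wordClass (letters p) = wordClass (letters q) ↔ SgDeducible wLambdaIdentities p q := by
  rw [wordClass_letters, wordClass_letters, WithOne.coe_inj]
  exact deducibleCon.eq

lemma wordClass_surjective : Function.Surjective wordClass := by
  intro x
  obtain rfl | ⟨a, rfl⟩ := RelFree.eq_one_or_coe x
  · exact ⟨[], rfl⟩
  · induction a using Con.induction_on with
    | H p => exact ⟨letters p, wordClass_letters p⟩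

lemma wordClass_eq_one_iff {w : List ℕ} : wordClass w = 1 ↔ w = [] := by
  cases w with
  | nil => simp
  | cons a s =>
    simpa using RelFree.mul_ne_one_left (wordClass s) (gen_ne_one a)

/-- The four identities hold in the relatively free semigroup. -/
lemma quotient_identity {e : SgIdentity} (he : e ∈ wLambdaIdentities)
    (g : ℕ → deducibleCon.Quotient) :
    FreeSemigroup.lift g e.lhs = FreeSemigroup.lift g e.rhs := by
  obtain ⟨f, rfl⟩ : ∃ f : ℕ → SgWord, g = fun n => (f n : deducibleCon.Quotient) := by
    choose f hf using fun n => Quotient.exists_rep (g n)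
    exact ⟨f, funext fun n => (hf n).symm⟩
  have key : ∀ p : SgWord, FreeSemigroup.lift (fun n => (f n : deducibleCon.Quotient)) p =
      ((FreeSemigroup.lift f p : SgWord) : deducibleCon.Quotient) := by
    intro p
    induction p using SgWord.induction with
    | h1 n => simp [letter]
    | h2 n q ih => rw [map_mul, map_mul, ih, Con.coe_mul]; simp [letter]
  rw [key, key]
  exact deducibleCon.eq.2 (.subst e he _)

namespace RelFree

/-- A product of two elements different from `1`. -/
def Long (m : RelFree) : Prop := ∃ a b : RelFree, a ≠ 1 ∧ b ≠ 1 ∧ m = a * b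

lemma Long.mul_right {m : RelFree} (h : Long m) (x : RelFree) : Long (m * x) := by
  obtain ⟨a, b, ha, hb, rfl⟩ := h
  exact ⟨a, b * x, ha, mul_ne_one_left x hb, mul_assoc _ _ _⟩

lemma mul_self_cube (x : RelFree) : x * x = x * x * x := by
  obtain rfl | ⟨a, rfl⟩ := RelFree.eq_one_or_coe x
  · simp
  · have := quotient_identity (e := ⟨letter 0 * letter 0, letter 0 * letter 0 * letter 0⟩)
      (by simp [wLambdaIdentities]) (fun _ => a)
    simp only [map_mul, letter, FreeSemigroup.lift_of] at this
    exact_mod_cast this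

lemma sandwich {x : RelFree} (hx : x ≠ 1) (y : RelFree) :
    x * y * x = x * y * x * y * x := by
  obtain rfl | ⟨a, rfl⟩ := RelFree.eq_one_or_coe x
  · exact absurd rfl hx
  · obtain rfl | ⟨b, rfl⟩ := RelFree.eq_one_or_coe y
    · simpa using mul_self_cube (a : RelFree)
    · have := quotient_identity (e := ⟨letter 0 * letter 1 * letter 0,
        letter 0 * letter 1 * letter 0 * letter 1 * letter 0⟩)
        (by simp [wLambdaIdentities]) (fun n => if n = 0 then a else b)
      simp [map_mul, letter, FreeSemigroup.lift_of] at this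
      exact_mod_cast this

lemma squares_comm {m : RelFree} (hm : Long m) (x y : RelFree) :
    m * (x * x) * (y * y) = m * (y * y) * (x * x) := by
  obtain ⟨a, b, ha, hb, rfl⟩ := hm
  obtain rfl | ⟨a, rfl⟩ := RelFree.eq_one_or_coe a
  · exact absurd rfl ha
  obtain rfl | ⟨b, rfl⟩ := RelFree.eq_one_or_coe b
  · exact absurd rfl hb
  obtain rfl | ⟨c, rfl⟩ := RelFree.eq_one_or_coe x
  · simp
  obtain rfl | ⟨d, rfl⟩ := RelFree.eq_one_or_coe y
  · simp
  have := quotient_identity (e := ⟨letter 0 * letter 1 * (letter 2 * letter 2) *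
        (letter 3 * letter 3), letter 0 * letter 1 * (letter 3 * letter 3) *
        (letter 2 * letter 2)⟩)
    (by simp [wLambdaIdentities])
    (fun n => if n = 0 then a else if n = 1 then b else if n = 2 then c else d)
  simp [map_mul, letter, FreeSemigroup.lift_of] at this
  exact_mod_cast this

lemma square_mul_square (x y : RelFree) : x * x * (y * y) = x * (y * y) * x := by
  obtain rfl | ⟨a, rfl⟩ := RelFree.eq_one_or_coe x
  · simp
  · obtain rfl | ⟨b, rfl⟩ := RelFree.eq_one_or_coe y
    · simp
    · have := quotient_identity (e := ⟨letter 0 * letter 0 * (letter 1 * letter 1),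
        letter 0 * (letter 1 * letter 1) * letter 0⟩)
        (by simp [wLambdaIdentities]) (fun n => if n = 0 then a else b)
      simp [map_mul, letter, FreeSemigroup.lift_of] at this
      exact_mod_cast this

/-! ### Letters inside an `R`-class -/

/-- Inside an `R`-class of long elements a nontrivial factor `c` labels at most one edge: if both
`m` and `m * r` admit a multiplication by `c` that can be undone, then they coincide. -/
lemma eq_mul_of_two_edges {m c s r t : RelFree} (hm : Long m) (hc : c ≠ 1)
    (h1 : m = m * c * s) (h2 : m = m * r * c * t) : m = m * r := by
  -- First the endpoints `m * c` and `m * r * c` of the two edges are shown to agree.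
  have hend : m * c = m * r * c := by
    have e1 : m * c * (s * r * c) = m * r * c := by
      rw [show m * c * (s * r * c) = (m * c * s) * r * c by simp only [mul_assoc], ← h1]
    have e2 : m * r * c * (t * c) = m * c := by
      rw [← mul_assoc, ← h2]
    have e3 : m * r * c * (s * r * c) = m * r * c := by
      calc m * r * c * (s * r * c) = m * (c * (s * r) * c * (s * r) * c) := by
            rw [← e1]; simp only [mul_assoc]
        _ = m * r * c := by rw [← sandwich hc, ← e1]; simp only [mul_assoc]
    have e4 : m * c * (t * c) = m * c := by
      calc m * c * (t * c) = m * r * (c * t * c * t * c) := by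
            rw [← e2]; simp only [mul_assoc]
        _ = m * c := by rw [← sandwich hc, ← e2]; simp only [mul_assoc]
    have hcomm := squares_comm (hm.mul_right c) (t * c) (s * r * c)
    rw [← mul_assoc (m * c), e4, e4, ← mul_assoc (m * c), e1, e3, ← mul_assoc (m * r * c), e2,
      e4] at hcomm
    exact hcomm.symm
  have f1 : m * (c * s) = m := by rw [← mul_assoc, ← h1]
  have f2 : m * (c * s * r) = m * r := by rw [← mul_assoc, f1]
  have f3 : m * r * (c * s * r) = m * r := by
    rw [show m * r * (c * s * r) = m * r * c * s * r by simp only [mul_assoc], ← hend, ← h1]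
  have f4 : m * r * (c * s) = m := by rw [← mul_assoc, ← hend, ← h1]
  have hcomm := squares_comm hm (c * s) (c * s * r)
  rw [← mul_assoc m, f1, f1, ← mul_assoc m, f2, f3, ← mul_assoc (m * r), f4, f1] at hcomm
  exact hcomm.symm

/-- The factor `c` can be read, after some `r`, from `m` inside the `R`-class of `m`. -/
def Active (m c : RelFree) : Prop := ∃ r t : RelFree, m = m * r * c * t

lemma state_unique {m c r t r' t' : RelFree} (hm : Long m) (hc : c ≠ 1)
    (h : m = m * r * c * t) (h' : m = m * r' * c * t') : m * r = m * r' := by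
  have := eq_mul_of_two_edges (m := m * r) (c := c) (s := t * r) (r := c * t * r')
    (t := t' * r) (hm.mul_right r) hc
    (by rw [← mul_assoc (m * r * c), ← h])
    (by
      rw [show m * r * (c * t * r') * c * (t' * r) = (m * r * c * t) * r' * c * t' * r by
        simp only [mul_assoc], ← h, ← h'])
  rw [this, show m * r * (c * t * r') = (m * r * c * t) * r' by simp only [mul_assoc], ← h]

end RelFree

/-! ### A concrete model of `W_λ` -/

/-- Codes for the elements of `W_λ`: `zero` codes zero, and `arrow i j f k` codes a nonzero element,
read as an arrow from `i` to `j`. The arrow starts at `false` when the element begins with `a` and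
ends at `true` when it ends with `a`, so that a product is nonzero exactly when the arrows compose.
The entry `f` records whether the first letter other than `a` is `x` (`some true`) or `y`
(`some false`), and `k` whether the element is a product of two elements. -/
inductive WVal : Type
  | zero
  | arrow (i j : Bool) (f : Option Bool) (k : Bool)
  deriving DecidableEq

namespace WVal

instance : Mul WVal where
  mul
    | arrow i j f _, arrow i' j' f' _ => if j = i' then arrow i j' (f.or f') true else zero
    | _, _ => zero

lemma arrow_mul (i j f k i' j' f' k') :
    arrow i j f k * arrow i' j' f' k' = if j = i' then arrow i j' (f.or f') true else zero := rfl

lemma zero_mul (p : WVal) : zero * p = zero := rfl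

lemma mul_zero (p : WVal) : p * zero = zero := by cases p <;> rfl

instance : Semigroup WVal where
  mul_assoc := by
    rintro (_ | ⟨i, j, f, k⟩) (_ | ⟨i', j', f', k'⟩) (_ | ⟨i'', j'', f'', k''⟩)
    all_goals try simp only [zero_mul, mul_zero]
    by_cases h : j = i' <;> by_cases h' : j' = i'' <;>
      simp [h, h', arrow_mul, zero_mul, mul_zero, Option.or_assoc]

/-- The code of a generator of `W_λ`. -/
def ofGen : WGen → WVal
  | .a => arrow false true none false
  | .x => arrow true false (some true) false
  | .y => arrow true false (some false) false

/-- The code of an element of the free semigroup with zero. -/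
def ofFree : WFree →ₙ* WVal where
  toFun w := WithZero.recZeroCoe zero (FreeSemigroup.lift ofGen) w
  map_mul' p q := by
    induction p using WithZero.recZeroCoe with
    | zero => rw [MulZeroClass.zero_mul]; rfl
    | coe p =>
      induction q using WithZero.recZeroCoe with
      | zero => rw [MulZeroClass.mul_zero]; exact (mul_zero _).symm
      | coe q => exact map_mul (FreeSemigroup.lift ofGen) p q

lemma ofFree_wgen (g : WGen) : ofFree (wgen g) = ofGen g := rfl

lemma ofFree_zero : ofFree 0 = zero := rfl

lemma ofFree_eq_of_conGen {p q : WFree} (h : conGen WRel p q) : ofFree p = ofFree q := by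
  have hle : conGen WRel ≤ Con.ker ofFree := by
    rw [Con.conGen_le]
    intro p q h
    rw [Con.ker_rel]
    cases h <;> simp only [map_mul, ofFree_wgen, ofFree_zero] <;> decide
  exact hle h

/-- The code of an element of `W_λ`. -/
def code : WLambda →ₙ* WVal where
  toFun w := Con.liftOn w ofFree fun _ _ h => ofFree_eq_of_conGen h
  map_mul' p q := by
    induction p using Con.induction_on
    induction q using Con.induction_on
    exact map_mul ofFree _ _

end WVal

namespace WLambda

open WVal

/-- A generator of `W_λ`. -/
def wg (g : WGen) : WLambda := (wgen g : WFree)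

/-- The zero of `W_λ`. -/
def wz : WLambda := ((0 : WFree) : (conGen WRel).Quotient)

lemma wz_mul (w : WLambda) : wz * w = wz := by
  induction w using Con.induction_on with
  | H p => rw [wz, ← Con.coe_mul, MulZeroClass.zero_mul]

lemma mul_wz (w : WLambda) : w * wz = wz := by
  induction w using Con.induction_on with
  | H p => rw [wz, ← Con.coe_mul, MulZeroClass.mul_zero]

lemma coe_eq_of_rel {p q : WFree} (h : WRel p q) :
    ((p : (conGen WRel).Quotient) : WLambda) = q :=
  (conGen WRel).eq.2 (ConGen.Rel.of _ _ h)

lemma aa : wg .a * wg .a = wz := coe_eq_of_rel .aa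
lemma xx : wg .x * wg .x = wz := coe_eq_of_rel .xx
lemma yy : wg .y * wg .y = wz := coe_eq_of_rel .yy
lemma xy : wg .x * wg .y = wz := coe_eq_of_rel .xy
lemma yx : wg .y * wg .x = wz := coe_eq_of_rel .yx
lemma axax : wg .a * (wg .x * (wg .a * wg .x)) = wg .a * wg .x := by
  have h : wg .a * wg .x = wg .a * wg .x * wg .a * wg .x := coe_eq_of_rel .ax
  simpa only [mul_assoc] using h.symm
lemma ayay : wg .a * (wg .y * (wg .a * wg .y)) = wg .a * wg .y := by
  have h : wg .a * wg .y = wg .a * wg .y * wg .a * wg .y := coe_eq_of_rel .ay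
  simpa only [mul_assoc] using h.symm
lemma xaxa : wg .x * (wg .a * (wg .x * wg .a)) = wg .x * wg .a := by
  have h : wg .x * wg .a = wg .x * wg .a * wg .x * wg .a := coe_eq_of_rel .xa
  simpa only [mul_assoc] using h.symm
lemma yaya : wg .y * (wg .a * (wg .y * wg .a)) = wg .y * wg .a := by
  have h : wg .y * wg .a = wg .y * wg .a * wg .y * wg .a := coe_eq_of_rel .ya
  simpa only [mul_assoc] using h.symm
lemma xay : wg .x * (wg .a * wg .y) = wg .x * (wg .a * wg .x) := by
  have h : wg .x * wg .a * wg .y = wg .x * wg .a * wg .x := coe_eq_of_rel .xay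
  simpa only [mul_assoc] using h
lemma yax : wg .y * (wg .a * wg .x) = wg .y * (wg .a * wg .y) := by
  have h : wg .y * wg .a * wg .x = wg .y * wg .a * wg .y := coe_eq_of_rel .yax
  simpa only [mul_assoc] using h

/-- The element of `W_λ` with a given code; codes without an element are sent to zero. -/
def decode : WVal → WLambda
  | arrow false true none false => wg .a
  | arrow true false (some true) false => wg .x
  | arrow true false (some false) false => wg .y
  | arrow false false (some true) true => wg .a * wg .x
  | arrow false false (some false) true => wg .a * wg .y
  | arrow true true (some true) true => wg .x * wg .a
  | arrow true true (some false) true => wg .y * wg .a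
  | arrow false true (some true) true => wg .a * (wg .x * wg .a)
  | arrow false true (some false) true => wg .a * (wg .y * wg .a)
  | arrow true false (some true) true => wg .x * (wg .a * wg .x)
  | arrow true false (some false) true => wg .y * (wg .a * wg .y)
  | _ => wz

/-- The codes of the twelve elements of `W_λ`. -/
def codes : List WVal :=
  [zero, arrow false true none false, arrow true false (some true) false,
    arrow true false (some false) false, arrow false false (some true) true,
    arrow false false (some false) true, arrow true true (some true) true,
    arrow true true (some false) true, arrow false true (some true) true,
    arrow false true (some false) true, arrow true false (some true) true,
    arrow true false (some false) true]

lemma code_wg (g : WGen) : code (wg g) = ofGen g := rfl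

lemma code_wz : code wz = zero := rfl

lemma code_decode : ∀ p ∈ codes, code (decode p) = p := by
  simp only [codes, List.forall_mem_cons, decode, map_mul, code_wg, code_wz]
  refine ⟨?_, ?_, ?_, ?_, ?_, ?_, ?_, ?_, ?_, ?_, ?_, ?_, by simp⟩ <;> decide

lemma wg_mul_decode (g : WGen) : ∀ p ∈ codes,
    ofGen g * p ∈ codes ∧ wg g * decode p = decode (ofGen g * p) := by
  have xaya : wg .x * (wg .a * (wg .y * wg .a)) = wg .x * wg .a := by
    rw [← mul_assoc (wg .a), ← mul_assoc, xay]; simpa only [mul_assoc] using xaxa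
  have yaxa : wg .y * (wg .a * (wg .x * wg .a)) = wg .y * wg .a := by
    rw [← mul_assoc (wg .a), ← mul_assoc, yax]; simpa only [mul_assoc] using yaya
  have aa' (w) : wg .a * (wg .a * w) = wz := by rw [← mul_assoc, aa, wz_mul]
  have xx' (w) : wg .x * (wg .x * w) = wz := by rw [← mul_assoc, xx, wz_mul]
  have yy' (w) : wg .y * (wg .y * w) = wz := by rw [← mul_assoc, yy, wz_mul]
  have xy' (w) : wg .x * (wg .y * w) = wz := by rw [← mul_assoc, xy, wz_mul]
  have yx' (w) : wg .y * (wg .x * w) = wz := by rw [← mul_assoc, yx, wz_mul]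
  have hmem : ∀ p ∈ codes, ofGen g * p ∈ codes := by cases g <;> decide
  refine fun p hp => ⟨hmem p hp, ?_⟩
  revert p
  cases g <;> simp only [codes, List.forall_mem_cons, ofGen, arrow_mul, Option.or,
    if_true, if_false, decode, reduceCtorEq, aa, xx, yy, xy, yx, axax, ayay, xaxa, yaya, xay, yax,
    xaya, yaxa, aa', xx', yy', xy', yx', mul_wz, true_and] <;> simp

lemma code_mem_and_decode_code (w : WLambda) : code w ∈ codes ∧ decode (code w) = w := by
  induction w using Con.induction_on with
  | H p =>
    induction p using WithZero.recZeroCoe with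
    | zero => exact ⟨by decide, rfl⟩
    | coe p =>
      induction p using FreeSemigroup.recOnMul with
      | ih1 g => cases g <;> exact ⟨by decide, rfl⟩
      | ih2 g p _ ih =>
        have h : (((FreeSemigroup.of g * p : FreeSemigroup WGen) : WFree) :
            (conGen WRel).Quotient) = wg g * ((p : WFree) : (conGen WRel).Quotient) := rfl
        obtain ⟨h1, h2⟩ := wg_mul_decode g _ ih.1
        rw [h, map_mul, code_wg]
        exact ⟨h1, by rw [← h2, ih.2]⟩

lemma code_mem (w : WLambda) : code w ∈ codes := (code_mem_and_decode_code w).1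

lemma code_injective : Function.Injective code :=
  Function.LeftInverse.injective fun w => (code_mem_and_decode_code w).2

lemma exists_code_eq {i j : Bool} {f : Option Bool} (h : f = none → i = false ∧ j = true) :
    ∃ w k, code w = arrow i j f k := by
  have : ∃ k, arrow i j f k ∈ codes := by
    revert i j f; decide
  obtain ⟨k, hk⟩ := this
  exact ⟨_, k, code_decode _ hk⟩

lemma mul_self_eq (w : WLambda) : w * w = w * w * w := by
  have h : ∀ p ∈ codes, p * p = p * p * p := by decide
  exact code_injective (by simpa only [map_mul] using h _ (code_mem w))

lemma sandwich_eq (v w : WLambda) : v * w * v = v * w * v * w * v := by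
  have h : ∀ p ∈ codes, ∀ q ∈ codes, p * q * p = p * q * p * q * p := by decide
  exact code_injective (by simpa only [map_mul] using h _ (code_mem v) _ (code_mem w))

lemma square_mul_square_eq (v w : WLambda) : v * v * (w * w) = v * (w * w) * v := by
  have h : ∀ p ∈ codes, ∀ q ∈ codes, p * p * (q * q) = p * (q * q) * p := by decide
  exact code_injective (by simpa only [map_mul] using h _ (code_mem v) _ (code_mem w))

lemma squares_comm_eq (s t v w : WLambda) :
    s * t * (v * v) * (w * w) = s * t * (w * w) * (v * v) := by
  have h : ∀ p ∈ codes, ∀ q ∈ codes, ∀ e ∈ codes.map (fun c => c * c),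
      ∀ f ∈ codes.map (fun c => c * c), p * q * e * f = p * q * f * e := by
    have h1 : ∀ p ∈ codes, ∀ q ∈ codes, p * q ∈ codes.drop 4 ∨ p * q = zero := by decide
    have h2 : ∀ e ∈ codes.map (fun c => c * c), e ∈ (codes.drop 4).take 4 ∨ e = zero := by
      decide
    have h3 : ∀ p ∈ codes.drop 4, ∀ e ∈ (codes.drop 4).take 4, ∀ f ∈ (codes.drop 4).take 4,
      p * e * f = p * f * e := by decide
    intro p hp q hq e he f hf
    rcases h1 p hp q hq with h | h
    · rcases h2 e he with he | rfl
      · rcases h2 f hf with hf | rfl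
        · exact h3 _ h _ he _ hf
        · simp only [mul_zero, zero_mul]
      · simp only [mul_zero, zero_mul]
    · simp only [h, zero_mul]
  refine code_injective ?_
  simp only [map_mul]
  exact h _ (code_mem s) _ (code_mem t) _ (List.mem_map_of_mem (code_mem v)) _
    (List.mem_map_of_mem (code_mem w))

/-- `W_λ` satisfies the four identities. -/
theorem satisfies_identities : varietyDefinedBy wLambdaIdentities WLambda := by
  intro e he φ
  simp only [wLambdaIdentities, Set.mem_insert_iff, Set.mem_singleton_iff] at he
  rcases he with rfl | rfl | rfl | rfl <;> simp only [map_mul]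
  · exact mul_self_eq _
  · exact sandwich_eq _ _
  · exact squares_comm_eq _ _ _ _
  · exact square_mul_square_eq _ _

end WLambda

/-! ### Words as walks in graphs -/

/-- The letter `c` is read as an edge from `l c` to `r c` of a graph with vertex set `β`;
`Walk l r i w j` says that the word `w` is a walk from `i` to `j`. -/
def Walk {β : Type*} (l r : ℕ → β) : β → List ℕ → β → Prop
  | i, [], j => i = j
  | i, c :: w, j => i = l c ∧ Walk l r (r c) w j

namespace Walk

variable {β : Type*} {l r : ℕ → β}

@[simp] lemma nil_iff {i j : β} : Walk l r i [] j ↔ i = j := Iff.rfl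

@[simp] lemma cons_iff {c : ℕ} {w : List ℕ} {i j : β} :
    Walk l r i (c :: w) j ↔ i = l c ∧ Walk l r (r c) w j := Iff.rfl

lemma append_iff {v w : List ℕ} {i j : β} :
    Walk l r i (v ++ w) j ↔ ∃ k, Walk l r i v k ∧ Walk l r k w j := by
  induction v generalizing i with
  | nil => simp
  | cons c v ih => simp [ih, and_assoc]

lemma append {v w : List ℕ} {i k j : β} (hv : Walk l r i v k) (hw : Walk l r k w j) :
    Walk l r i (v ++ w) j := append_iff.2 ⟨k, hv, hw⟩

lemma right_unique {w : List ℕ} {i j k : β} (h : Walk l r i w j) (h' : Walk l r i w k) :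
    j = k := by
  induction w generalizing i with
  | nil => exact h.symm.trans h'
  | cons c w ih => exact ih h.2 h'.2

lemma of_append_right {v w : List ℕ} {i j k : β} (h : Walk l r i (v ++ w) j)
    (hv : Walk l r i v k) : Walk l r k w j := by
  obtain ⟨k', h1, h2⟩ := append_iff.1 h
  exact h1.right_unique hv ▸ h2

lemma congr {l' r' : ℕ → β} {w : List ℕ} {i j : β} (h : Walk l r i w j)
    (hw : ∀ c ∈ w, l c = l' c ∧ r c = r' c) : Walk l' r' i w j := by
  induction w generalizing i with
  | nil => exact h
  | cons c w ih =>
    have hc := hw c (by simp)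
    exact ⟨h.1.trans hc.1, hc.2 ▸ ih h.2 fun d hd => hw d (by simp [hd])⟩

lemma map {γ : Type*} (χ : β → γ) {w : List ℕ} {i j : β} (h : Walk l r i w j) :
    Walk (χ ∘ l) (χ ∘ r) (χ i) w (χ j) := by
  induction w generalizing i with
  | nil => exact congrArg χ h
  | cons c w ih => exact ⟨congrArg χ h.1, ih h.2⟩

lemma of_map {γ : Type*} {χ : β → γ} (hχ : Function.Injective χ) {w : List ℕ} {i j : β}
    (h : Walk (χ ∘ l) (χ ∘ r) (χ i) w (χ j)) : Walk l r i w j := by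
  induction w generalizing i with
  | nil => exact hχ h
  | cons c w ih => exact ⟨hχ h.1, ih h.2⟩

lemma eq_of_forall_bool {x y : β} (h : ∀ χ : β → Bool, χ x = χ y) : x = y := by
  classical
  simpa using h fun z => decide (z = y)

/-- Walks can be recognised by means of the maps to two-vertex graphs. -/
lemma of_forall_bool {w : List ℕ} {i j : β}
    (h : ∀ χ : β → Bool, Walk (χ ∘ l) (χ ∘ r) (χ i) w (χ j)) : Walk l r i w j := by
  induction w generalizing i with
  | nil => exact eq_of_forall_bool h
  | cons c w ih => exact ⟨eq_of_forall_bool fun χ => (h χ).1, ih fun χ => (h χ).2⟩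

end Walk

/-- Two nonempty words have the same shape when they contain the same letters, are walks with the
same ends in the same graphs, have the same first letter and, unless that letter is forced to be a
loop, the same second letter. -/
structure SameShape (u v : List ℕ) : Prop where
  left_ne_nil : u ≠ []
  right_ne_nil : v ≠ []
  mem_iff : ∀ c, c ∈ u ↔ c ∈ v
  walk_iff : ∀ {β : Type} (l r : ℕ → β) (i j : β), Walk l r i u j ↔ Walk l r i v j
  start : u.take 2 = v.take 2 ∨ ∃ h q q', u = h :: q ∧ v = h :: q' ∧
    ∀ {β : Type} (l r : ℕ → β) (i j : β), Walk l r i u j → l h = r h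

lemma SameShape.symm {u v : List ℕ} (h : SameShape u v) : SameShape v u where
  left_ne_nil := h.right_ne_nil
  right_ne_nil := h.left_ne_nil
  mem_iff c := (h.mem_iff c).symm
  walk_iff l r i j := (h.walk_iff l r i j).symm
  start := h.start.imp Eq.symm fun ⟨c, q, q', h1, h2, h3⟩ =>
    ⟨c, q', q, h2, h1, fun l r i j hw => h3 l r i j ((h.walk_iff l r i j).2 hw)⟩

/-! ### What the identities of `W_λ` say about words -/

/-- The first mark occurring along a word. -/
def firstMark (f : ℕ → Option Bool) : List ℕ → Option Bool
  | [] => none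
  | c :: w => (f c).or (firstMark f w)

section Evaluation

open WVal

variable {Φ : SgWord →ₙ* WVal} {l r : ℕ → Bool} {f : ℕ → Option Bool}

lemma eval_eq_arrow_iff (hΦ : ∀ c, ∃ k, Φ (letter c) = arrow (l c) (r c) (f c) k) (p : SgWord)
    (i j : Bool) (g : Option Bool) :
    (∃ k, Φ p = arrow i j g k) ↔ Walk l r i (letters p) j ∧ g = firstMark f (letters p) := by
  induction p using SgWord.induction generalizing i j g with
  | h1 n =>
    obtain ⟨k, hk⟩ := hΦ n
    simp only [hk, letters_letter, arrow.injEq, Walk.cons_iff, Walk.nil_iff, firstMark,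
      Option.or_none]
    constructor
    · rintro ⟨_, rfl, rfl, rfl, _⟩; simp
    · rintro ⟨⟨rfl, rfl⟩, rfl⟩; simp
  | h2 n q ih =>
    obtain ⟨k, hk⟩ := hΦ n
    simp only [map_mul, letters_mul, letters_letter, List.cons_append, List.nil_append,
      Walk.cons_iff, firstMark, hk]
    constructor
    · rintro ⟨k', h⟩
      cases hq : Φ q with
      | zero => rw [hq, WVal.mul_zero] at h; cases h
      | arrow i' j' f' k'' =>
        obtain ⟨h1, h2⟩ := (ih i' j' f').1 ⟨k'', hq⟩
        rw [hq, arrow_mul] at h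
        split_ifs at h with hr
        cases h
        exact ⟨⟨rfl, hr ▸ h1⟩, by rw [h2]⟩
    · rintro ⟨⟨rfl, hw⟩, rfl⟩
      obtain ⟨k', hk'⟩ := (ih _ _ _).2 ⟨hw, rfl⟩
      exact ⟨true, by rw [hk', arrow_mul, if_pos rfl]⟩

lemma eval_eq_zero {c : ℕ} (hc : Φ (letter c) = zero) {p : SgWord} (hp : c ∈ letters p) :
    Φ p = zero := by
  induction p using SgWord.induction with
  | h1 n =>
    rw [letters_letter, List.mem_singleton] at hp
    rw [← hp, hc]
  | h2 n q ih =>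
    rw [map_mul]
    rw [letters_mul, letters_letter, List.mem_append, List.mem_singleton] at hp
    rcases hp with rfl | hp
    · rw [hc, WVal.zero_mul]
    · rw [ih hp, WVal.mul_zero]

end Evaluation

section Shape

open WVal WLambda

variable {p q : SgWord}

/-- Evaluating an identity of `W_λ` at elements with prescribed codes. -/
lemma eval_transfer (h : SgSatisfies WLambda ⟨p, q⟩) {l r : ℕ → Bool} {f : ℕ → Option Bool}
    (hf : ∀ c, f c = none → l c = false ∧ r c = true) {i j : Bool}
    (hw : Walk l r i (letters p) j) :
    Walk l r i (letters q) j ∧ firstMark f (letters p) = firstMark f (letters q) := by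
  choose g k hg using fun c => exists_code_eq (hf c)
  have hΦ : ∀ c, ∃ k, (code.comp (FreeSemigroup.lift g)) (letter c) =
      arrow (l c) (r c) (f c) k := fun c => ⟨k c, by simp [letter, hg]⟩
  obtain ⟨k', hk'⟩ := (eval_eq_arrow_iff hΦ p i j _).2 ⟨hw, rfl⟩
  have hpq := congrArg code (h (FreeSemigroup.lift g))
  refine (eval_eq_arrow_iff hΦ q i j _).1 ⟨k', ?_⟩
  rw [← hk']
  exact hpq.symm

lemma walk_transfer (h : SgSatisfies WLambda ⟨p, q⟩) {β : Type} (l r : ℕ → β) (i j : β)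
    (hw : Walk l r i (letters p) j) : Walk l r i (letters q) j :=
  Walk.of_forall_bool fun χ =>
    (eval_transfer h (f := fun _ => some true) (by simp) (hw.map χ)).1

lemma mem_transfer (h : SgSatisfies WLambda ⟨p, q⟩) {c : ℕ} (hc : c ∈ letters p) :
    c ∈ letters q := by
  by_contra hq
  obtain ⟨w, k, hw⟩ := exists_code_eq (i := false) (j := false) (f := some true) (by simp)
  have h0 : code (FreeSemigroup.lift (fun d => if d = c then wz else w) p) = zero :=
    eval_eq_zero (Φ := code.comp (FreeSemigroup.lift _)) (c := c) (by simp [letter, code_wz]) hc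
  have h1 := congrArg code (h (FreeSemigroup.lift fun d => if d = c then wz else w))
  simp only [h0] at h1
  have key : ∀ s : SgWord, c ∉ letters s →
      ∃ k, code (FreeSemigroup.lift (fun d => if d = c then wz else w) s) =
        arrow false false (some true) k := by
    intro s hs
    induction s using SgWord.induction with
    | h1 n =>
      rw [letters_letter, List.mem_singleton] at hs
      exact ⟨k, by simp [letter, Ne.symm hs, hw]⟩
    | h2 n s ih =>
      rw [letters_mul, letters_letter, List.mem_append, List.mem_singleton, not_or] at hs
      obtain ⟨k', hk'⟩ := ih hs.2
      refine ⟨true, ?_⟩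
      rw [map_mul, map_mul, hk']
      simp [letter, Ne.symm hs.1, hw, arrow_mul]
  obtain ⟨k', hk'⟩ := key q hq
  rw [hk'] at h1
  cases h1

lemma head_transfer (h : SgSatisfies WLambda ⟨p, q⟩) : q.head = p.head := by
  -- Every letter is sent to `xa` or `ya`, so that only the mark of the first letter is seen.
  have hloop : ∀ w, Walk (fun _ => true) (fun _ => true) true w true := by
    intro w
    induction w with
    | nil => rfl
    | cons c w ih => exact ⟨rfl, ih⟩
  have := (eval_transfer h (f := fun c => some (decide (c = p.head))) (by simp)
    (hloop (letters p))).2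
  simpa [letters, firstMark] using this.symm

lemma second_transfer (h : SgSatisfies WLambda ⟨p, q⟩) :
    (letters p).take 2 = (letters q).take 2 ∨
      ∀ {β : Type} (l r : ℕ → β) (i j : β), Walk l r i (letters p) j → l p.head = r p.head := by
  by_cases hl : ∀ (l r : ℕ → Bool) (i j : Bool), Walk l r i (letters p) j → l p.head = r p.head
  · refine .inr fun l r i j hw => Walk.eq_of_forall_bool fun χ => hl _ _ _ _ (hw.map χ)
  left
  -- Up to exchanging the two vertices, the first letter can be sent to `a`.
  obtain ⟨l, r, i, j, hw, h0, h1⟩ : ∃ (l r : ℕ → Bool) (i j : Bool),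
      Walk l r i (letters p) j ∧ l p.head = false ∧ r p.head = true := by
    push Not at hl
    obtain ⟨l, r, i, j, hw, hne⟩ := hl
    cases h0 : l p.head
    · exact ⟨l, r, i, j, hw, h0, by simpa [h0] using hne.symm⟩
    · refine ⟨_, _, _, _, hw.map not, by simp [h0], ?_⟩
      simpa [h0] using hne.symm
  have hq := walk_transfer h l r i j hw
  have hh := head_transfer h
  obtain ⟨a, s⟩ := p
  obtain ⟨b, t⟩ := q
  dsimp only [letters] at *
  subst hh
  -- A letter that can be read second starts at `true`, hence is not the first letter.
  have hsec : ∀ {d w}, Walk l r i (b :: d :: w) j → d ≠ b := by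
    rintro d w hw rfl
    have := hw.2.1
    rw [h0, h1] at this
    cases this
  have key : ∀ e, firstMark (fun c => if c = b then none else some (decide (c = e))) (b :: s) =
      firstMark (fun c => if c = b then none else some (decide (c = e))) (b :: t) := by
    intro e
    refine (eval_transfer h (l := l) (r := r) ?_ hw).2
    intro c hc
    have : c = b := by by_contra hcb; simp [hcb] at hc
    rw [this]; exact ⟨h0, h1⟩
  cases s with
  | nil =>
    cases t with
    | nil => rfl
    | cons d t => simpa [firstMark, hsec hq] using key d
  | cons d s =>
    cases t with
    | nil => simpa [firstMark, hsec hw] using key d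
    | cons e t =>
      have := key d
      simp only [firstMark, if_true, Option.none_or, hsec hw, hsec hq, if_false, Option.some_or,
        Option.some.injEq] at this
      simpa [eq_comm] using this

/-- The two sides of an identity of `W_λ` have the same shape. -/
theorem sameShape_of_satisfies (h : SgSatisfies WLambda ⟨p, q⟩) :
    SameShape (letters p) (letters q) where
  left_ne_nil := List.cons_ne_nil _ _
  right_ne_nil := List.cons_ne_nil _ _
  mem_iff _ := ⟨mem_transfer h, mem_transfer fun φ => (h φ).symm⟩
  walk_iff l r i j := ⟨walk_transfer h l r i j, walk_transfer (fun φ => (h φ).symm) l r i j⟩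
  start := (second_transfer h).imp_right fun hl =>
    ⟨p.head, p.tail, q.tail, rfl, by rw [← head_transfer h]; rfl, hl⟩

end Shape

/-! ### Deducible identities hold -/

lemma SgDeducible.satisfies {B : Set SgIdentity} {p q : SgWord} (h : SgDeducible B p q)
    {T : Type u} [Semigroup T] (hT : varietyDefinedBy B T) : SgSatisfies T ⟨p, q⟩ := by
  induction h with
  | subst e he σ => exact fun φ => hT e he (φ.comp σ)
  | refl p => exact fun φ => rfl
  | symm _ ih => exact fun φ => (ih φ).symm
  | trans _ _ ih1 ih2 => exact fun φ => (ih1 φ).trans (ih2 φ)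
  | mul _ _ ih1 ih2 =>
    intro φ
    simp only [map_mul]
    exact congrArg₂ _ (ih1 φ) (ih2 φ)

/-- Words with the same class in the relatively free semigroup have the same shape. -/
lemma sameShape_of_wordClass_eq {u v : List ℕ} (hu : u ≠ []) (h : wordClass u = wordClass v) :
    SameShape u v := by
  have hv : v ≠ [] := by
    rintro rfl
    exact hu (wordClass_eq_one_iff.1 h)
  obtain ⟨p, rfl⟩ := exists_letters hu
  obtain ⟨q, rfl⟩ := exists_letters hv
  exact sameShape_of_satisfies
    ((wordClass_letters_eq_iff.1 h).satisfies WLambda.satisfies_identities)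

/-! ### The final strongly connected part of a word -/

open RelFree

/-- A word splits as `y ++ w`, where all letters of `w` are active for the whole word and `w` is cut
off from `y` by the last letter `b` of `y`, which occurs only once; or `y` is empty. -/
structure Cut (y w : List ℕ) : Prop where
  active : ∀ c ∈ w, Active (wordClass (y ++ w)) (gen c)
  bridge : y = [] ∨ ∃ x b, y = x ++ [b] ∧ b ∉ x ∧ b ∉ w ∧ ∀ c ∈ x, c ∉ w

lemma long_wordClass {u : List ℕ} (hu : 2 ≤ u.length) : Long (wordClass u) := by
  match u, hu with
  | a :: b :: s, _ =>
    exact ⟨gen a, gen b * wordClass s, gen_ne_one a, mul_ne_one_left _ (gen_ne_one b), by simp⟩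

/-- If an active letter occurs both before and after `b`, then `b` is active. -/
lemma active_of_mem_before {x₁ x₂ w₁ w₂ : List ℕ} {b c : ℕ}
    (hc : Active (wordClass (x₁ ++ c :: x₂ ++ b :: (w₁ ++ c :: w₂))) (gen c)) :
    Active (wordClass (x₁ ++ c :: x₂ ++ b :: (w₁ ++ c :: w₂))) (gen b) := by
  obtain ⟨r, t, h⟩ := hc
  set m := wordClass (x₁ ++ c :: x₂ ++ b :: (w₁ ++ c :: w₂)) with hm
  simp only [wordClass_append, wordClass_cons] at hm
  set X := wordClass x₂ * gen b * wordClass w₁ with hX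
  set Y := wordClass w₂ * r with hY
  refine ⟨r * gen c * wordClass x₂, wordClass w₁ * gen c * Y * gen c * t, ?_⟩
  have h1 : gen c * X * gen c * Y * gen c =
      gen c * X * gen c * Y * gen c * X * gen c * Y * gen c := by
    have := sandwich (gen_ne_one c) (X * gen c * Y)
    simpa only [mul_assoc] using this
  calc m = m * r * gen c * t := h
    _ = wordClass x₁ * (gen c * X * gen c * Y * gen c) * t := by
        rw [hm]; simp only [hX, hY, mul_assoc]
    _ = wordClass x₁ * (gen c * X * gen c * Y * gen c * X * gen c * Y * gen c) * t := by
        rw [← h1]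
    _ = _ := by rw [hm]; simp only [hX, hY, mul_assoc]

/-- A letter that occurs twice and is followed by active letters only is active. -/
lemma active_of_twice {x₁ x₂ w : List ℕ} {b : ℕ}
    (hw : ∀ c ∈ w, Active (wordClass (x₁ ++ b :: x₂ ++ b :: w)) (gen c)) :
    Active (wordClass (x₁ ++ b :: x₂ ++ b :: w)) (gen b) := by
  set m := wordClass (x₁ ++ b :: x₂ ++ b :: w) with hm
  simp only [wordClass_append, wordClass_cons] at hm
  have hb := sandwich (gen_ne_one b) (wordClass x₂)
  cases w with
  | nil =>
    refine ⟨wordClass x₂, 1, ?_⟩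
    calc m = wordClass x₁ * (gen b * wordClass x₂ * gen b) := by
          rw [hm]; simp only [wordClass_nil, mul_assoc, mul_one]
      _ = _ := by rw [hb, hm]; simp only [wordClass_nil, mul_assoc, mul_one]
  | cons d w =>
    obtain ⟨r, t, h⟩ := hw d (by simp)
    rw [wordClass_cons] at hm
    set y := wordClass x₂ * gen b with hy
    set g := gen d * wordClass w * r with hg
    have hmr : m * r = wordClass x₁ * gen b * y * g := by
      rw [hm]; simp only [hy, hg, mul_assoc]
    have hgg : g * gen d = g * g * gen d := by
      have := sandwich (gen_ne_one d) (wordClass w * r)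
      simpa only [hg, mul_assoc] using this
    have hyy : gen b * y = gen b * y * (y * y) := by
      have h1 : gen b * y = gen b * y * y := by simpa only [hy, mul_assoc] using hb
      rw [← mul_assoc (gen b * y), ← h1, ← h1]
    have hlong : Long (wordClass x₁ * gen b * y) :=
      ⟨wordClass x₁ * gen b, y, mul_ne_one_right _ (gen_ne_one b),
        mul_ne_one_right _ (gen_ne_one b), rfl⟩
    refine ⟨r * g * wordClass x₂, y * gen d * t, ?_⟩
    -- Squaring the loops `y` and `g` lets them be exchanged, which puts `b` after `w`.
    calc m = m * r * gen d * t := h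
      _ = wordClass x₁ * (gen b * y) * (g * gen d) * t := by rw [hmr]; simp only [mul_assoc]
      _ = wordClass x₁ * gen b * y * (y * y) * (g * g) * gen d * t := by
          rw [hyy, hgg]; simp only [mul_assoc]
      _ = wordClass x₁ * gen b * y * (g * g) * (y * y) * gen d * t := by
          rw [squares_comm hlong]
      _ = m * r * g * y * y * gen d * t := by rw [hmr]; simp only [mul_assoc]
      _ = _ := by simp only [hy, mul_assoc]

/-- Every word has all letters active, or is cut by an inactive letter into two parts with disjoint
contents, the second of which has active letters only. -/
lemma exists_cut (u : List ℕ) : Cut [] u ∨ ∃ x b w, u = x ++ b :: w ∧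
    ¬ Active (wordClass u) (gen b) ∧ Cut (x ++ [b]) w := by
  classical
  by_cases hall : ∀ c ∈ u, Active (wordClass u) (gen c)
  · exact .inl ⟨hall, .inl rfl⟩
  right
  obtain ⟨x, b, w, hu, hb, hw⟩ : ∃ x b w, u = x ++ b :: w ∧ ¬ Active (wordClass u) (gen b) ∧
      ∀ c ∈ w, Active (wordClass u) (gen c) := by
    generalize wordClass u = m at hall ⊢
    induction u with
    | nil => simp at hall
    | cons d s ih =>
      by_cases hs : ∀ c ∈ s, Active m (gen c)
      · refine ⟨[], d, s, rfl, fun hd => hall ?_, hs⟩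
        intro c hc
        rcases List.mem_cons.1 hc with rfl | hc
        exacts [hd, hs c hc]
      · obtain ⟨x, b, w, rfl, h1, h2⟩ := ih hs
        exact ⟨d :: x, b, w, rfl, h1, h2⟩
  subst hu
  refine ⟨x, b, w, rfl, hb, ⟨by simpa using hw, .inr ⟨x, b, rfl, ?_, ?_, ?_⟩⟩⟩
  · intro hbx
    obtain ⟨x₁, x₂, rfl⟩ := List.append_of_mem hbx
    exact hb (active_of_twice hw)
  · exact fun hbw => hb (hw b hbw)
  · intro c hcx hcw
    have hc := hw c hcw
    obtain ⟨x₁, x₂, rfl⟩ := List.append_of_mem hcx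
    obtain ⟨w₁, w₂, rfl⟩ := List.append_of_mem hcw
    exact hb (active_of_mem_before hc)

/-- Active letters can be read from the end of the word. -/
lemma exists_word_of_active {u : List ℕ} {c : ℕ} (h : Active (wordClass u) (gen c)) :
    ∃ r t, wordClass u = wordClass (u ++ r ++ c :: t) := by
  obtain ⟨r, t, h⟩ := h
  obtain ⟨r, rfl⟩ := wordClass_surjective r
  obtain ⟨t, rfl⟩ := wordClass_surjective t
  exact ⟨r, t, by rw [h]; simp [mul_assoc]⟩

/-- The end of `w` is joined to its beginning by a walk. -/
lemma Cut.exists_return {y w : List ℕ} (hc : Cut y w) :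
    ∃ z, ∀ {β : Type} (l r : ℕ → β) (i k j : β), Walk l r i y k → Walk l r k w j →
      Walk l r j z k := by
  cases w with
  | nil => exact ⟨[], fun l r i k j _ h => h.symm⟩
  | cons d w =>
    obtain ⟨z, t, h⟩ := exists_word_of_active (hc.active d (by simp))
    refine ⟨z, fun {β} l r i k j hy hw => ?_⟩
    have := ((sameShape_of_wordClass_eq (by simp) h).walk_iff l r i j).1 (hy.append hw)
    rw [List.append_assoc] at this
    obtain ⟨k', hz, hd⟩ := Walk.append_iff.1 (this.of_append_right (hy.append hw))
    rwa [hw.1, ← hd.1]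

/-- The state from which the letter `c` can be read inside the `R`-class of `m`; for letters that
are not active the value `1` is a placeholder. -/
noncomputable def stateBefore (m : RelFree) (c : ℕ) : RelFree :=
  open Classical in if h : Active m (gen c) then m * h.choose else 1

lemma stateBefore_eq {m r t : RelFree} {c : ℕ} (hm : Long m) (h : m = m * r * gen c * t) :
    stateBefore m c = m * r := by
  have hA : Active m (gen c) := ⟨r, t, h⟩
  rw [stateBefore, dif_pos hA]
  exact state_unique hm (gen_ne_one c) hA.choose_spec.choose_spec h

/-- Consecutive letters have consecutive states. -/
lemma stateBefore_mul_of_factor {p q : List ℕ} {c d : ℕ}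
    (hm : Long (wordClass (p ++ c :: d :: q)))
    (hc : Active (wordClass (p ++ c :: d :: q)) (gen c)) :
    stateBefore (wordClass (p ++ c :: d :: q)) c * gen c =
      stateBefore (wordClass (p ++ c :: d :: q)) d := by
  obtain ⟨r, t, h⟩ := hc
  set m := wordClass (p ++ c :: d :: q) with hmdef
  simp only [wordClass_append, wordClass_cons] at hmdef
  rw [stateBefore_eq hm h, mul_assoc, eq_comm]
  refine stateBefore_eq (t := wordClass q * r * gen c * t) hm ?_
  have hs := sandwich (gen_ne_one c) (gen d * wordClass q * r)
  calc m = m * r * gen c * t := h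
    _ = wordClass p * (gen c * (gen d * wordClass q * r) * gen c) * t := by
        rw [hmdef]; simp only [mul_assoc]
    _ = _ := by rw [hs, hmdef]; simp only [mul_assoc]

/-- Reading the last letter leads back to the word itself. -/
lemma stateBefore_mul_last {p : List ℕ} {c : ℕ} (hm : Long (wordClass (p ++ [c])))
    (hc : Active (wordClass (p ++ [c])) (gen c)) :
    stateBefore (wordClass (p ++ [c])) c * gen c = wordClass (p ++ [c]) := by
  obtain ⟨r, t, h⟩ := hc
  set m := wordClass (p ++ [c]) with hmdef
  simp only [wordClass_append, wordClass_cons, wordClass_nil, mul_one] at hmdef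
  rw [stateBefore_eq hm h]
  have hs := sandwich (gen_ne_one c) r
  have h' : m = m * (r * gen c * r) * gen c * t := by
    calc m = m * r * gen c * t := h
      _ = wordClass p * (gen c * r * gen c) * t := by rw [hmdef]; simp only [mul_assoc]
      _ = _ := by rw [hs, hmdef]; simp only [mul_assoc]
  have hn : m * r = m * (r * gen c * r) := state_unique hm (gen_ne_one c) h h'
  have hn' : m * (r * gen c) * (r * gen c) = m * (r * gen c) := by
    rw [show m * (r * gen c) * (r * gen c) = m * (r * gen c * r) * gen c by
      simp only [mul_assoc], ← hn, mul_assoc]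
  have := eq_mul_of_two_edges (m := m) (c := r * gen c) (s := t) (r := r * gen c) (t := t) hm
    (mul_ne_one_right _ (gen_ne_one c)) (by rw [← mul_assoc]; exact h)
    (by rw [hn', ← mul_assoc]; exact h)
  rw [mul_assoc, ← this]

/-- The sources of the letters in the graph of states: the letters of `w` are edges of the `R`-class
of `m`, and all other letters start at the additional vertex `none`. -/
noncomputable def stateSource (m : RelFree) (w : List ℕ) (c : ℕ) : Option RelFree :=
  if c ∈ w then some (stateBefore m c) else none

/-- The targets of the letters in the graph of states: the letter `b` enters the `R`-class of `m` at
`e`, and the letters other than `b` and those of `w` are loops at `none`. -/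
noncomputable def stateTarget (m : RelFree) (w : List ℕ) (b : ℕ) (e : Option RelFree) (c : ℕ) :
    Option RelFree :=
  if c ∈ w then some (stateBefore m c * gen c) else if c = b then e else none

lemma walk_states_suffix {y w s : List ℕ} (hc : Cut y w) (hm : Long (wordClass (y ++ w)))
    (b : ℕ) (e : Option RelFree) (hs : s <:+ w) (hne : s ≠ []) :
    Walk (stateSource (wordClass (y ++ w)) w) (stateTarget (wordClass (y ++ w)) w b e)
      (stateSource (wordClass (y ++ w)) w (s.head hne)) s (some (wordClass (y ++ w))) := by
  induction s with
  | nil => exact absurd rfl hne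
  | cons c s ih =>
    have hcw : c ∈ w := hs.subset (by simp)
    refine ⟨rfl, ?_⟩
    obtain ⟨g, rfl⟩ := hs
    rw [stateTarget, if_pos hcw]
    cases s with
    | nil =>
      have hA := hc.active c hcw
      rw [← List.append_assoc] at hm hA ⊢
      rw [stateBefore_mul_last hm hA]
      rfl
    | cons d s =>
      have := ih ⟨g ++ [c], by simp⟩ (by simp)
      have hA := hc.active c hcw
      have hd : d ∈ g ++ c :: d :: s := by simp
      rw [List.head_cons, stateSource, if_pos hd] at this
      rw [← List.append_assoc] at hm hA this ⊢
      rwa [stateBefore_mul_of_factor hm hA]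

/-- The word is a walk in its graph of states, ending at its own class. -/
lemma exists_walk_states {y w : List ℕ} (hc : Cut y w) (hm : Long (wordClass (y ++ w)))
    (hw : w ≠ []) : ∃ b e i k,
      Walk (stateSource (wordClass (y ++ w)) w) (stateTarget (wordClass (y ++ w)) w b e) i y k ∧
      Walk (stateSource (wordClass (y ++ w)) w) (stateTarget (wordClass (y ++ w)) w b e) k w
        (some (wordClass (y ++ w))) := by
  set m := wordClass (y ++ w) with hmdef
  rcases hc.bridge with hy | ⟨x, b, hy, hbx, hbw, hxw⟩
  · exact ⟨0, none, _, _, by rw [hy]; rfl,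
      walk_states_suffix hc hm 0 none List.suffix_rfl hw⟩
  · set e := stateSource m w (w.head hw)
    refine ⟨b, e, none, e, ?_, walk_states_suffix hc hm b e List.suffix_rfl hw⟩
    rw [hy]
    refine Walk.append (k := none) ?_ ?_
    · clear hy
      induction x with
      | nil => rfl
      | cons c x ih =>
        simp only [List.mem_cons, not_or] at hbx
        have hcw := hxw c (by simp)
        refine ⟨by rw [stateSource, if_neg hcw], ?_⟩
        rw [stateTarget, if_neg hcw, if_neg (Ne.symm hbx.1)]
        exact ih hbx.2 fun d hd => hxw d (by simp [hd])
    · exact ⟨by rw [stateSource, if_neg hbw], by simp [stateTarget, hbw]⟩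

lemma walk_states_eq {m n k : RelFree} {w s : List ℕ} {b : ℕ} {e : Option RelFree}
    (h : Walk (stateSource m w) (stateTarget m w b e) (some n) s (some k)) :
    n * wordClass s = k := by
  induction s generalizing n with
  | nil => simpa using h
  | cons c s ih =>
    obtain ⟨h1, h2⟩ := h
    rw [stateSource] at h1
    split_ifs at h1 with hc
    rw [stateTarget, if_pos hc, ← Option.some.inj h1] at h2
    rw [wordClass_cons, ← mul_assoc]
    exact ih h2

/-- A word that is a closed walk at the end of `y ++ w` can be appended. -/
lemma Cut.append_closed {y w s : List ℕ} (hc : Cut y w) (hlen : 2 ≤ (y ++ w).length)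
    (hw : w ≠ [])
    (hs : ∀ {β : Type} (l r : ℕ → β) (i k j : β), Walk l r i y k → Walk l r k w j →
      Walk l r j s j) :
    wordClass (y ++ w ++ s) = wordClass (y ++ w) := by
  obtain ⟨b, e, i, k, h1, h2⟩ := exists_walk_states hc (long_wordClass hlen) hw
  rw [wordClass_append (y ++ w) s]
  exact walk_states_eq (hs _ _ _ _ _ h1 h2)

/-! ### Comparing two words with the same walks -/

/-- The sources of the letters in a two-vertex graph: the letters of `w` are loops at `true`, the
letter `b` leads from `false` to `true`, and all other letters are loops at `false`. -/
def cutSource (w : List ℕ) (c : ℕ) : Bool := decide (c ∈ w)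

/-- The targets of the edges described in `cutSource`. -/
def cutTarget (w : List ℕ) (b c : ℕ) : Bool := decide (c ∈ w) || decide (c = b)

lemma walk_cut_of_subset {w s : List ℕ} {b : ℕ} (h : ∀ c ∈ s, c ∈ w) :
    Walk (cutSource w) (cutTarget w b) true s true := by
  induction s with
  | nil => rfl
  | cons c s ih =>
    have hc := h c (by simp)
    refine ⟨by simp [cutSource, hc], ?_⟩
    simpa [cutTarget, hc] using ih fun d hd => h d (by simp [hd])

lemma walk_cut {x w : List ℕ} {b : ℕ} (hbx : b ∉ x) (hbw : b ∉ w) (hx : ∀ c ∈ x, c ∉ w) :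
    Walk (cutSource w) (cutTarget w b) false (x ++ b :: w) true := by
  induction x with
  | nil =>
    refine ⟨by simp [cutSource, hbw], ?_⟩
    simpa [cutTarget] using walk_cut_of_subset (b := b) (w := w) fun c hc => hc
  | cons c x ih =>
    simp only [List.mem_cons, not_or] at hbx
    have hc := hx c (by simp)
    refine ⟨by simp [cutSource, hc], ?_⟩
    simpa [cutTarget, hc, Ne.symm hbx.1] using ih hbx.2 fun d hd => hx d (by simp [hd])

lemma subset_of_walk_cut {w s : List ℕ} {b : ℕ} {j : Bool}
    (h : Walk (cutSource w) (cutTarget w b) true s j) : ∀ c ∈ s, c ∈ w := by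
  induction s with
  | nil => simp
  | cons c s ih =>
    have hc : c ∈ w := by simpa [cutSource] using h.1
    have h2 := h.2
    simp only [cutTarget, hc, decide_true, Bool.true_or] at h2
    simpa [hc] using ih h2

lemma exists_of_walk_cut {w s : List ℕ} {b : ℕ}
    (h : Walk (cutSource w) (cutTarget w b) false s true) :
    ∃ x w', s = x ++ b :: w' ∧ b ∉ x ∧ (∀ c ∈ x, c ∉ w) ∧ ∀ c ∈ w', c ∈ w := by
  induction s with
  | nil => cases h
  | cons c s ih =>
    have hc : c ∉ w := by simpa [cutSource] using h.1
    have h2 := h.2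
    by_cases hcb : c = b
    · subst hcb
      simp only [cutTarget, decide_true, Bool.or_true] at h2
      exact ⟨[], s, rfl, by simp, by simp, subset_of_walk_cut h2⟩
    · simp only [cutTarget, hc, hcb, decide_false, Bool.or_false] at h2
      obtain ⟨x, w', rfl, h3, h4, h5⟩ := ih h2
      exact ⟨c :: x, w', rfl, by simp [h3, Ne.symm hcb], by simpa [hc] using h4, h5⟩

/-- Activity of the letters of the final part depends only on the walks. -/
lemma Cut.of_walk_iff {y w w' : List ℕ} (hc : Cut y w) (hw : w ≠ [])
    (hmem : ∀ c, c ∈ w ↔ c ∈ w')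
    (h : ∀ {β : Type} (l r : ℕ → β) (i j : β), Walk l r i (y ++ w) j ↔ Walk l r i (y ++ w') j) :
    Cut y w' := by
  refine ⟨?_, ?_⟩
  · rcases exists_cut (y ++ w') with hA | ⟨x, b, w₂, hv, -, hcut⟩
    · exact fun c hc' => hA.active c (by simp [hc'])
    -- The letter `b` that cuts `y ++ w'` does not occur in `w'`, since it also cuts `y ++ w`, so
    -- that it cannot be read from the end of `y ++ w`.
    have hb : b ∉ w' := by
      intro hb
      obtain ⟨z, t, hzt⟩ := exists_word_of_active (hc.active b ((hmem b).2 hb))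
      obtain hnil | ⟨x', b', hxb, hbx, hbw, hxw⟩ := hcut.bridge
      · simp at hnil
      obtain ⟨rfl, hbb⟩ := List.append_inj' hxb rfl
      obtain rfl : b = b' := by simpa using hbb
      have hwalk : Walk (cutSource w₂) (cutTarget w₂ b) false (y ++ w) true := by
        rw [h, hv]; exact walk_cut hbx hbw hxw
      have h2 := ((sameShape_of_wordClass_eq (by simp [hw]) hzt).walk_iff _ _ _ _).1 hwalk
      rw [List.append_assoc] at h2
      have h3 := subset_of_walk_cut (h2.of_append_right hwalk)
      exact hbw (h3 b (by simp))
    intro c hc'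
    have hcw : c ∈ w₂ := by
      rcases List.append_eq_append_iff.1 hv with ⟨s, rfl, hs⟩ | ⟨s, rfl, hs⟩
      · cases s with
        | nil =>
          rw [List.nil_append] at hs
          exact absurd (by rw [hs]; simp) hb
        | cons d s => exact absurd (by rw [hs]; simp) hb
      · cases s with
        | nil => exact absurd (by rw [← List.nil_append w', ← hs]; simp) hb
        | cons d s =>
          rw [List.cons_append, List.cons.injEq] at hs
          rw [hs.2]; simp [hc']
    have := hcut.active c hcw
    rwa [hv, show x ++ b :: w₂ = x ++ [b] ++ w₂ by simp]
  · refine hc.bridge.imp_right ?_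
    rintro ⟨x, b, h1, h2, h3, h4⟩
    exact ⟨x, b, h1, h2, mt (hmem b).2 h3, fun c hcx => mt (hmem c).2 (h4 c hcx)⟩

/-- Two words with the same walks and a common prefix of length at least two, which reaches into
their final parts, have the same class. With `z` a return walk, the first word equals
`(y g) (q z g)² (q' z g)² q'` and the second `(y g) (q' z g)² (q z g)² q'`. -/
lemma wordClass_eq_of_common_prefix {y g q q' : List ℕ} (hc : Cut y (g ++ q))
    (hc' : Cut y (g ++ q')) (hlen : 2 ≤ (y ++ g).length) (hw : g ++ q ≠ []) (hw' : g ++ q' ≠ [])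
    (h : ∀ {β : Type} (l r : ℕ → β) (i j : β),
      Walk l r i (y ++ (g ++ q)) j ↔ Walk l r i (y ++ (g ++ q')) j) :
    wordClass (y ++ (g ++ q)) = wordClass (y ++ (g ++ q')) := by
  obtain ⟨z, hz⟩ := hc.exists_return
  have key : ∀ {β : Type} (l r : ℕ → β) (i k j : β), Walk l r i y k → Walk l r k (g ++ q) j →
      Walk l r k (g ++ q') j →
      ∃ k', Walk l r k' q j ∧ Walk l r k' q' j ∧ Walk l r j (z ++ g) k' := by
    intro β l r i k j hy hq hq'
    obtain ⟨k', hg, hk'⟩ := Walk.append_iff.1 hq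
    exact ⟨k', hk', hq'.of_append_right hg, (hz l r i k j hy hq).append hg⟩
  have e1 := hc.append_closed (s := z ++ g ++ (q ++ (z ++ g ++ (q' ++ (z ++ g ++ (q' ++
    (z ++ g ++ q'))))))) (by simp at hlen ⊢; omega) hw (fun {β} l r i k j hy hk => by
      have hk2 := ((h l r i j).1 (hy.append hk)).of_append_right hy
      obtain ⟨k', h1, h2, h3⟩ := key l r i k j hy hk hk2
      exact h3.append (h1.append (h3.append (h2.append (h3.append (h2.append (h3.append h2)))))))
  have e2 := hc'.append_closed (s := z ++ g ++ (q' ++ (z ++ g ++ (q ++ (z ++ g ++ (q ++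
    (z ++ g ++ q'))))))) (by simp at hlen ⊢; omega) hw' (fun {β} l r i k j hy hk => by
      have hk2 := ((h l r i j).2 (hy.append hk)).of_append_right hy
      obtain ⟨k', h1, h2, h3⟩ := key l r i k j hy hk2 hk
      exact h3.append (h2.append (h3.append (h1.append (h3.append (h1.append (h3.append h2)))))))
  have hcomm := squares_comm (long_wordClass hlen) (wordClass (q ++ (z ++ g)))
    (wordClass (q' ++ (z ++ g)))
  rw [← e1, ← e2]
  have := congrArg (· * wordClass q') hcomm
  simpa only [wordClass_append, mul_assoc] using this

/-- A first letter that is forced to be a loop may be doubled. -/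
lemma wordClass_cons_loop {h : ℕ} {q : List ℕ} (hc : Cut [] (h :: q)) (hq : q ≠ [])
    (hl : ∀ {β : Type} (l r : ℕ → β) (i j : β), Walk l r i (h :: q) j → l h = r h) :
    wordClass (h :: h :: q) = wordClass (h :: q) ∧ Cut [] (h :: h :: q) := by
  have hwalk : ∀ {β : Type} (l r : ℕ → β) (i j : β),
      Walk l r i (h :: q) j ↔ Walk l r i (h :: h :: q) j := by
    intro β l r i j
    refine ⟨fun hw => ⟨hw.1, (hl l r i j hw).symm, hw.2⟩, fun hw => ⟨hw.1, hw.2.2⟩⟩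
  have hc2 : Cut [] (h :: h :: q) :=
    hc.of_walk_iff (by simp) (by simp) fun l r i j => hwalk l r i j
  refine ⟨?_, hc2⟩
  obtain ⟨z, hz⟩ := hc.exists_return
  have key : ∀ {β : Type} (l r : ℕ → β) (i j : β), Walk l r i (h :: q) j →
      Walk l r j z i ∧ Walk l r i q j := by
    intro β l r i j hw
    have hlp := hl l r i j hw
    exact ⟨hz l r i i j rfl hw, by rw [hw.1, hlp]; exact hw.2⟩
  have hlen : 1 ≤ q.length := List.length_pos_iff.2 hq
  have e1 := hc.append_closed (s := z ++ (q ++ (z ++ h :: q))) (by simpa using hlen) (by simp)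
    (fun {β} l r i k j hy hk => by
      obtain ⟨h1, h2⟩ := key l r k j hk
      exact h1.append (h2.append (h1.append hk)))
  have e2 := hc2.append_closed (s := z ++ (q ++ (z ++ q))) (by simp) (by simp)
    (fun {β} l r i k j hy hk => by
      obtain ⟨h1, h2⟩ := key l r k j ((hwalk l r k j).2 hk)
      exact h1.append (h2.append (h1.append h2)))
  have hs := square_mul_square (gen h) (wordClass (q ++ z))
  simp only [List.nil_append] at e1 e2
  rw [← e1, ← e2]
  have := congrArg (· * wordClass q) hs
  simpa only [wordClass_append, wordClass_cons, List.cons_append, mul_assoc] using this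

/-- If all letters are active, words of the same shape have the same class. -/
lemma wordClass_eq_of_cut_nil {u v : List ℕ} (h : SameShape u v) (hc : Cut [] u) :
    wordClass u = wordClass v := by
  have hc' : Cut [] v := hc.of_walk_iff h.left_ne_nil h.mem_iff fun l r i j => h.walk_iff l r i j
  rcases h.start with hs | ⟨a, q, q', rfl, rfl, hl⟩
  · match u, v, hs with
    | [], _, _ => exact absurd rfl h.left_ne_nil
    | _, [], _ => exact absurd rfl h.right_ne_nil
    | [a], [b], hs => simp at hs; rw [hs]
    | [a], b :: c :: t, hs => simp at hs
    | a :: b :: s, [c], hs => simp at hs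
    | a :: b :: s, c :: d :: t, hs =>
      simp only [List.take_succ_cons, List.take_zero, List.cons.injEq, and_true] at hs
      obtain ⟨rfl, rfl⟩ := hs
      exact wordClass_eq_of_common_prefix (y := []) (g := [a, b]) hc hc' (by simp) (by simp)
        (by simp) h.walk_iff
  · have hne : ∀ s : List ℕ,
        (∀ {β : Type} (l r : ℕ → β) (i j : β), Walk l r i (a :: s) j → l a = r a) → s ≠ [] := by
      rintro s hs rfl
      have := hs (fun _ => false) (fun _ => true) false true ⟨rfl, rfl⟩
      cases this
    have hl' : ∀ {β : Type} (l r : ℕ → β) (i j : β), Walk l r i (a :: q') j → l a = r a :=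
      fun l r i j hw => hl l r i j ((h.walk_iff l r i j).2 hw)
    obtain ⟨e1, d1⟩ := wordClass_cons_loop hc (hne q hl) hl
    obtain ⟨e2, d2⟩ := wordClass_cons_loop hc' (hne q' hl') hl'
    rw [← e1, ← e2]
    have w1 := sameShape_of_wordClass_eq (by simp) e1
    have w2 := sameShape_of_wordClass_eq (by simp) e2
    exact wordClass_eq_of_common_prefix (y := []) (g := [a, a]) d1 d2 (by simp) (by simp)
      (by simp) fun l r i j => (w1.walk_iff l r i j).trans
        ((h.walk_iff l r i j).trans (w2.walk_iff l r i j).symm)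

/-- Walks before a letter that occurs only once are determined by the walks of the whole word. -/
lemma walk_before_bridge {x x' w w' : List ℕ} {b : ℕ} (hbx : b ∉ x) (hbw : b ∉ w)
    (hxw : ∀ c ∈ x, c ∉ w) (hx' : ∀ c ∈ x', c ∈ x)
    (h : ∀ {β : Type} (l r : ℕ → β) (i j : β), Walk l r i (x ++ b :: w) j →
      Walk l r i (x' ++ b :: w') j)
    {β : Type} {l r : ℕ → β} {i j : β} (hw : Walk l r i x j) :
    Walk l r i x' j ∧ ∃ (l' r' : ℕ → Option β) (i' j' : Option β),
      Walk l' r' i' (x ++ b :: w) j' ∧ ∀ c ∈ x, l' c = some (l c) ∧ r' c = some (r c) := by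
  -- One vertex `none` is added; `b` leads there, and all letters after `b` are loops there.
  let l' : ℕ → Option β := fun c => if c ∈ x then some (l c) else if c = b then some j else none
  let r' : ℕ → Option β := fun c => if c ∈ x then some (r c) else none
  have hl' : ∀ c ∈ x, l' c = some (l c) ∧ r' c = some (r c) := fun c hc => by simp [l', r', hc]
  have hloop : Walk l' r' none w none := by
    have : ∀ c ∈ w, l' c = none ∧ r' c = none := by
      intro c hc
      have hcx : c ∉ x := fun hcx => hxw c hcx hc
      have hcb : c ≠ b := fun hcb => hbw (hcb ▸ hc)
      simp [l', r', hcx, hcb]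
    clear hbw hxw h
    induction w with
    | nil => rfl
    | cons c w ih =>
      refine ⟨(this c (by simp)).1.symm, ?_⟩
      rw [(this c (by simp)).2]
      exact ih fun d hd => this d (by simp [hd])
  have hwhole : Walk l' r' (some i) (x ++ b :: w) none := by
    refine Walk.append (k := some j) ((hw.map some).congr fun c hc => ?_) ⟨?_, ?_⟩
    · exact ⟨(hl' c hc).1.symm, (hl' c hc).2.symm⟩
    · simp [l', hbx]
    · simpa [r', hbx] using hloop
  refine ⟨?_, l', r', some i, none, hwhole, hl'⟩
  obtain ⟨k, h1, h2⟩ := Walk.append_iff.1 (h l' r' _ _ hwhole)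
  have hk : k = some j := by
    rw [h2.1]; simp [l', hbx]
  subst hk
  exact Walk.of_map (Option.some_injective β) (h1.congr fun c hc => hl' c (hx' c hc))

/-- The parts before a letter that occurs only once have the same shape. -/
lemma SameShape.before_bridge {x x' w w' : List ℕ} {b : ℕ}
    (h : SameShape (x ++ b :: w) (x' ++ b :: w')) (hx : x ≠ []) (hbx : b ∉ x) (hbx' : b ∉ x')
    (hbw : b ∉ w) (hbw' : b ∉ w') (hxw : ∀ c ∈ x, c ∉ w) (hxw' : ∀ c ∈ x', c ∉ w')
    (hmem : ∀ c, c ∈ x ↔ c ∈ x') : SameShape x x' := by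
  have hx' : x' ≠ [] := by
    obtain ⟨a, ha⟩ := List.exists_mem_of_ne_nil x hx
    exact List.ne_nil_of_mem ((hmem a).1 ha)
  refine ⟨hx, hx', hmem, fun l r i j => ⟨fun hw => ?_, fun hw => ?_⟩, ?_⟩
  · exact (walk_before_bridge hbx hbw hxw (fun c => (hmem c).2)
      (fun l r i j => (h.walk_iff l r i j).1) hw).1
  · exact (walk_before_bridge hbx' hbw' hxw' (fun c => (hmem c).1)
      (fun l r i j => (h.walk_iff l r i j).2) hw).1
  · rcases h.start with hs | ⟨a, q, q', hu, hv, hl⟩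
    · left
      match x, x' with
      | [], _ => exact absurd rfl hx
      | _, [] => exact absurd rfl hx'
      | [a], [c] => simpa using hs
      | [a], c :: d :: s => simp at hs; simp [hs.2] at hbx'
      | a :: d :: s, [c] => simp at hs; simp [hs.2] at hbx
      | a :: d :: s, c :: e :: t => simpa using hs
    · right
      obtain ⟨c, s, rfl⟩ := List.exists_cons_of_ne_nil hx
      obtain ⟨d, t, rfl⟩ := List.exists_cons_of_ne_nil hx'
      rw [List.cons_append, List.cons.injEq] at hu hv
      obtain ⟨rfl, -⟩ := hu
      obtain ⟨rfl, -⟩ := hv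
      refine ⟨d, s, t, rfl, rfl, fun l r i j hw => ?_⟩
      obtain ⟨-, l', r', i', j', hw', hlr⟩ := walk_before_bridge hbx hbw hxw
        (fun c => (hmem c).2) (fun l r i j => (h.walk_iff l r i j).1) hw
      have := hl l' r' i' j' hw'
      rw [(hlr d (by simp)).1, (hlr d (by simp)).2] at this
      exact Option.some.inj this

/-- Words of the same shape have the same class in the relatively free semigroup. -/
theorem wordClass_eq_of_sameShape {u v : List ℕ} (h : SameShape u v) :
    wordClass u = wordClass v := by
  induction hn : u.length using Nat.strong_induction_on generalizing u v with
  | _ n ih =>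
  subst hn
  rcases exists_cut u with hc | ⟨x, b, w, rfl, -, hc⟩
  · exact wordClass_eq_of_cut_nil h hc
  obtain hnil | ⟨x₀, b₀, hxb, hbx, hbw, hxw⟩ := hc.bridge
  · simp at hnil
  obtain ⟨rfl, hbb⟩ := List.append_inj' hxb rfl
  obtain rfl : b = b₀ := by simpa using hbb
  have hcut := walk_cut hbx hbw hxw
  obtain ⟨x', w', rfl, hbx', hxw', hww'⟩ := exists_of_walk_cut ((h.walk_iff _ _ _ _).1 hcut)
  have hmem := h.mem_iff
  simp only [List.mem_append, List.mem_cons] at hmem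
  have hmemw : ∀ c, c ∈ w ↔ c ∈ w' := by
    refine fun c => ⟨fun hcw => ?_, hww' c⟩
    rcases (hmem c).1 (.inr (.inr hcw)) with hcx | rfl | hcw'
    · exact absurd hcw (hxw' c hcx)
    · exact absurd hcw hbw
    · exact hcw'
  have hmemx : ∀ c, c ∈ x ↔ c ∈ x' := by
    refine fun c => ⟨fun hcx => ?_, fun hcx => ?_⟩
    · rcases (hmem c).1 (.inl hcx) with hcx' | rfl | hcw'
      · exact hcx'
      · exact absurd hcx hbx
      · exact absurd (hww' c hcw') (hxw c hcx)
    · rcases (hmem c).2 (.inl hcx) with hcx' | rfl | hcw'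
      · exact hcx'
      · exact absurd hcx hbx'
      · exact absurd hcw' (hxw' c hcx)
  have hxx : wordClass x = wordClass x' := by
    by_cases hx : x = []
    · subst hx
      rw [show x' = [] from
        List.eq_nil_iff_forall_not_mem.2 fun c hc => by simpa using (hmemx c).2 hc]
    · exact ih x.length (by simp) (h.before_bridge hx hbx hbx' hbw (mt (hmemw b).2 hbw) hxw
        (fun c hc => mt (hmemw c).2 (hxw' c hc)) hmemx) rfl
  by_cases hw : w = []
  · subst hw
    obtain rfl : w' = [] :=
      List.eq_nil_iff_forall_not_mem.2 fun c hc => by simpa using (hmemw c).2 hc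
    simp [hxx]
  have hw' : w' ≠ [] := by
    obtain ⟨a, ha⟩ := List.exists_mem_of_ne_nil w hw
    exact List.ne_nil_of_mem ((hmemw a).1 ha)
  have hv : wordClass (x ++ [b] ++ w') = wordClass (x' ++ b :: w') := by simp [hxx]
  have hwalk : ∀ {β : Type} (l r : ℕ → β) (i j : β),
      Walk l r i (x ++ [b] ++ w) j ↔ Walk l r i (x ++ [b] ++ w') j := by
    intro β l r i j
    rw [(sameShape_of_wordClass_eq (by simp) hv).walk_iff, ← h.walk_iff]
    simp
  have hc' := hc.of_walk_iff hw hmemw hwalk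
  rw [← hv, show x ++ b :: w = x ++ [b] ++ w by simp]
  by_cases hx : x = []
  · subst hx
    obtain rfl : x' = [] :=
      List.eq_nil_iff_forall_not_mem.2 fun c hc => by simpa using (hmemx c).2 hc
    obtain ⟨d, s, rfl⟩ := List.exists_cons_of_ne_nil hw
    obtain ⟨e, t, rfl⟩ := List.exists_cons_of_ne_nil hw'
    rcases h.start with hs | ⟨a, q, q', hu, -, hl⟩
    · simp only [List.nil_append, List.take_succ_cons, List.take_zero, List.cons.injEq, and_true,
        true_and] at hs
      subst hs
      exact wordClass_eq_of_common_prefix (g := [d]) hc hc' (by simp) (by simp) (by simp) hwalk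
    · -- The first letter is the cutting letter, hence not a loop.
      rw [List.nil_append, List.cons.injEq] at hu
      obtain ⟨rfl, -⟩ := hu
      have := hl _ _ _ _ hcut
      simp only [cutSource, cutTarget, hbw, decide_false, decide_true, Bool.false_or] at this
      cases this
  · have hlen : 1 ≤ x.length := List.length_pos_iff.2 hx
    exact wordClass_eq_of_common_prefix (g := []) hc hc' (by simpa using hlen) hw hw' hwalk

/-- The identities of `W_λ` are the identities deducible from the four. -/
theorem satisfies_iff_deducible {p q : SgWord} :
    SgSatisfies WLambda ⟨p, q⟩ ↔ SgDeducible wLambdaIdentities p q :=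
  ⟨fun h => wordClass_letters_eq_iff.1 (wordClass_eq_of_sameShape (sameShape_of_satisfies h)),
    fun h => h.satisfies WLambda.satisfies_identities⟩

/-! ### From identities to varieties -/

/-- Members of the variety generated by `S` satisfy the identities of `S`. -/
lemma satisfies_of_varietyGeneratedBy {S : Type} [Semigroup S] {e : SgIdentity}
    (hS : SgSatisfies S e) {T : Type u} [Semigroup T] (hT : varietyGeneratedBy.{u} S T) :
    SgSatisfies T e := by
  obtain ⟨I, A, f, hf⟩ := hT
  intro φ
  choose g hg using fun n => hf (φ (letter n))
  have key : ∀ p, φ p = f (FreeSemigroup.lift g p) := by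
    intro p
    induction p using SgWord.induction with
    | h1 n => simp [letter, hg]
    | h2 n q ih => rw [map_mul, ih, ← hg]; simp [letter]
  rw [key, key]
  congr 1
  ext i
  exact hS ((Pi.evalMulHom (fun _ : I => S) i).comp
    ((MulMemClass.subtype A).comp (FreeSemigroup.lift g)))

lemma self_mem_varietyGeneratedBy (S : Type) [Semigroup S] :
    varietyGeneratedBy.{u} S (PUnit.{u + 1} → S) :=
  ⟨PUnit, ⊤, MulMemClass.subtype ⊤, fun g => ⟨⟨g, trivial⟩, rfl⟩⟩

lemma lift_congr {α : Type*} {T : Type*} [Semigroup T] {f g : α → T} {p : FreeSemigroup α}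
    (h : ∀ t ∈ letters p, f t = g t) : FreeSemigroup.lift f p = FreeSemigroup.lift g p := by
  induction p using FreeSemigroup.recOnMul with
  | ih1 t => simpa using h t (by simp [letters])
  | ih2 t p _ ih =>
    rw [map_mul, map_mul, ih fun s hs => h s (by rw [letters_mul]; simp [hs])]
    simpa using congrArg (· * _) (h t (by rw [letters_mul]; simp [letters]))

lemma apply_map_eq_lift {α R : Type*} [Semigroup R] (φ : SgWord →ₙ* R) (f : α → ℕ)
    (p : FreeSemigroup α) :
    φ (FreeSemigroup.map f p) = FreeSemigroup.lift (fun t => φ (letter (f t))) p := by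
  induction p using FreeSemigroup.recOnMul with
  | ih1 t => simp [letter]
  | ih2 t p _ ih => simp only [map_mul, ih]; simp [letter]

/-- If `T` satisfies all identities of `S`, then two words over `T` that agree under all maps from
`T` to `S` have the same value in `T`. -/
lemma lift_id_eq_of_forall {S : Type} [Semigroup S] {T : Type u} [Semigroup T]
    (hT : ∀ e, SgSatisfies S e → SgSatisfies T e) {p q : FreeSemigroup T}
    (h : ∀ g : T → S, FreeSemigroup.lift g p = FreeSemigroup.lift g q) :
    FreeSemigroup.lift id p = FreeSemigroup.lift id q := by
  classical
  -- The finitely many elements of `T` that occur are numbered by their positions in a list.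
  let L := letters p ++ letters q
  let num : T → ℕ := fun t => L.idxOf t
  let back : ℕ → T := fun n => L.getD n p.head
  have hback : ∀ t ∈ L, (back ∘ num) t = id t := fun t ht => by
    have hlt : L.idxOf t < L.length := List.idxOf_lt_length_iff.2 ht
    exact (List.getD_eq_getElem _ _ hlt).trans (List.getElem_idxOf hlt)
  have hS : SgSatisfies S ⟨FreeSemigroup.map num p, FreeSemigroup.map num q⟩ := by
    intro φ
    simp only [apply_map_eq_lift, h]
  have := hT _ hS (FreeSemigroup.lift back)
  simp only [apply_map_eq_lift] at this
  rw [lift_congr (p := p) (g := id), lift_congr (p := q) (g := id)] at this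
  · exact this
  · exact fun t ht => by simpa [letter] using hback t (by simp [L, ht])
  · exact fun t ht => by simpa [letter] using hback t (by simp [L, ht])

/-- Birkhoff's theorem: a semigroup that satisfies all identities of `S` is an image of a
subsemigroup of a power of `S`, namely of the
semigroup generated by the evaluations in `S ^ (S ^ T)`. -/
lemma varietyGeneratedBy_of_forall_satisfies {S : Type} [Semigroup S] {T : Type u} [Semigroup T]
    (hT : ∀ e, SgSatisfies S e → SgSatisfies T e) : varietyGeneratedBy.{u} S T := by
  let ev : FreeSemigroup T →ₙ* ((T → S) → S) := FreeSemigroup.lift fun t g => g t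
  have hev : ∀ (p : FreeSemigroup T) (g : T → S), ev p g = FreeSemigroup.lift g p := by
    intro p g
    induction p using FreeSemigroup.recOnMul with
    | ih1 t => simp [ev]
    | ih2 t p _ ih => rw [map_mul, map_mul, Pi.mul_apply, ih]; simp [ev]
  have hwd : ∀ p q, ev p = ev q → FreeSemigroup.lift id p = FreeSemigroup.lift id q :=
    fun p q h => lift_id_eq_of_forall hT fun g => by rw [← hev, ← hev, h]
  choose w hw using fun a : ev.srange => a.2
  refine ⟨T → S, ev.srange, ⟨fun a => FreeSemigroup.lift id (w a), fun a b => ?_⟩, fun t => ?_⟩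
  · rw [← map_mul]
    exact hwd _ _ (by rw [map_mul, hw, hw, hw]; rfl)
  · refine ⟨⟨ev (.of t), .of t, rfl⟩, ?_⟩
    exact (hwd _ (.of t) (hw _)).trans (by simp)

theorem mainTheorem5 :
    IsIdentityBasis wLambdaIdentities (varietyGeneratedBy.{u} WLambda) := by
  have hvar : ∀ (T : Type u) [Semigroup T],
      varietyGeneratedBy.{u} WLambda T ↔ varietyDefinedBy wLambdaIdentities T := fun T _ =>
    ⟨fun hT e he => satisfies_of_varietyGeneratedBy (WLambda.satisfies_identities e he) hT,
      fun hT => varietyGeneratedBy_of_forall_satisfies fun _ he =>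
        (satisfies_iff_deducible.1 he).satisfies hT⟩
  refine ⟨hvar, fun e => ⟨fun h => ?_, fun h T _ hT => h.satisfies ((hvar T).1 hT)⟩⟩
  refine satisfies_iff_deducible.1 fun φ => ?_
  have := h _ (self_mem_varietyGeneratedBy WLambda)
    (FreeSemigroup.lift fun n _ => φ (letter n))
  have key : ∀ p, FreeSemigroup.lift (fun n (_ : PUnit.{u + 1}) => φ (letter n)) p ⟨⟩ = φ p := by
    intro p
    induction p using SgWord.induction with
    | h1 n => simp [letter]
    | h2 n q ih => rw [map_mul, map_mul, Pi.mul_apply, ih]; simp [letter]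
  rw [← key, ← key, this]
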